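/- Let $n\ge 2$. For each $j<n$ let $\mathbf A_{0,j}\subseteq \mathbf A_{1,j}\subseteq\cdots$ be an increasing chain of finite linear orders (each a suborder of the next) with $|\mathbf A_{0,j}|=1$ and such that every finite linear order embeds into some $\mathbf A_{k,j}$ (for instance $\mathbf A_{k,j}=\{0,\dots,k\}$). The $n$-hypercube space $\mathcal H^n$ is the set of all sequences $B=\langle\langle n_k,(\mathbf B_{k,j})_{j<n}\rangle : k<\omega\rangle$ with $(n_k)_{k<\omega}$ a strictly increasing sequence of natural numbers and $\mathbf B_{k,j}$ a suborder of $\mathbf A_{n_k,j}$ isomorphic to $\mathbf A_{k,j}$. For $C=\langle\langle m_k,(\mathbf C_{k,j})_{j<n}\rangle: k<\omega\rangle$ and $B$ as above, put $C\le B$ if for each $k$ there is $l$ with $m_k=n_l$ and $\mathbf C_{k,j}\subseteq\mathbf B_{l,j}$ for all $j<n$. Let $\mathcal{AR}_1$ be the set of first blocks $r_1(B)=\langle n_0,(\mathbf B_{0,j})_{j<n}\rangle$ of members $B$ of $\mathcal H^n$, let $\mathcal{AR}_1{\upharpoonright}X=\{r_1(Y):Y\le X\}$, and let $X\le^*Y$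 mean that $(\mathcal{AR}_1{\upharpoonright}X)\setminus(\mathcal{AR}_1{\upharpoonright}Y)$ is finite. If $G$ is a generic filter for the forcing $(\mathcal H^n,\le^*)$, let $\mathcal V_n$ be the family, in the generic extension, of all $S\subseteq\mathcal{AR}_1$ with $S\supseteq\mathcal{AR}_1{\upharpoonright}X$ for some $X\in G$. For an ultrafilter $\mathcal U$ on a countable set $S$, $t(\mathcal U,2)$ denotes the least number $t$ such that for each $l\ge2$ and each coloring $c:[S]^2\to l$ there is $X\in\mathcal U$ such that $c$ takes at most $t$ values on $[X]^2$. Then it is forced by $(\mathcal H^n,\le^*)$ that $\mathcal V_n$ is an ultrafilter on $\mathcal{AR}_1$ and $$t(\mathcal V_n,2)=1+\sum_{i=0}^{n-1}3^i .$$ In particular, $t(\mathcal V_2,2)=5$. Likewise, consider Blass' square forcing, whose conditions are the sets $X\subseteq\omega\times\omega$ that contain, for every $m<\omega$, a product $s\times t$ with $|s|=|t|=m$, ordered by inclusion. It forces that the family of all subsets of $\omega\times\omega$ that include a member of the generic filter is an ultrafilter $\mathcal U$ on $\omega\times\omega$ with $t(\mathcal U,2)=5$. -/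

import Mathlib

/-! ### Forcing

Let `P` be a notion of forcing (smaller conditions are stronger). A sentence of the forcing
language is represented by the set of conditions that force it: `φ p` is read `p ⊩ φ`. The
connectives below are the usual clauses of the definition of the forcing relation. Quantifiers over
a type `ι` of ground-model objects are quantifiers over the elements of a ground-model set; since
every subset, in the generic extension, of a ground-model set `α` has a name consisting of pairs
`(a, p)` with `a ∈ α` and `p ∈ P`, quantification over all such subsets in the extension is
quantification over `Forcing.Name P α`. -/

namespace Forcing

/-- Sentences of the forcing language: `φ p` means that `p` forces `φ`. -/
abbrev Sentence (P : Type*) := P → Prop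

section Connectives

variable {P : Type*} [Preorder P]

/-- A statement `b` about ground-model objects that is absolute (its truth value does not change
in a generic extension), as a sentence of the forcing language. -/
def lift (b : Prop) : Sentence P := fun _ => b

def and (φ ψ : Sentence P) : Sentence P := fun p => φ p ∧ ψ p

def or (φ ψ : Sentence P) : Sentence P := fun p => ∀ q ≤ p, ∃ r ≤ q, φ r ∨ ψ r

def not (φ : Sentence P) : Sentence P := fun p => ∀ q ≤ p, ¬ φ q

def imp (φ ψ : Sentence P) : Sentence P := fun p => ∀ q ≤ p, φ q → ψ q

def all {ι : Sort*} (φ : ι → Sentence P) : Sentence P := fun p => ∀ x, φ x p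

def ex {ι : Sort*} (φ : ι → Sentence P) : Sentence P := fun p => ∀ q ≤ p, ∃ r ≤ q, ∃ x, φ x r

/-- `φ` holds in every generic extension: every condition forces `φ`. -/
def Forced (φ : Sentence P) : Prop := ∀ p, φ p

end Connectives

/-- Names for subsets (in the generic extension) of the ground-model set `α`. -/
abbrev Name (P α : Type*) := Set (α × P)

section Names

variable {P : Type*} [Preorder P] {α : Type*}

/-- The sentence `a ∈ S`, for `a` in the ground-model set `α`. -/
def mem (a : α) (S : Name P α) : Sentence P := fun p => ∀ q ≤ p, ∃ r ≤ q, ∃ s, (a, s) ∈ S ∧ r ≤ s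

/-- The sentence `A ∈ G`, where `G` is the generic filter. -/
def memGeneric (A : P) : Sentence P := fun p => ∀ q ≤ p, ∃ r ≤ q, r ≤ A

/-- Given a map `D` that sends each condition to a subset of `α`: the sentence that `S` is a member
of the family generated by the generic filter `G`, that is, `S ⊇ D A` for some `A ∈ G`. -/
def memGenerated (D : P → Set α) (S : Name P α) : Sentence P :=
  ex fun A : P => and (memGeneric A) (all fun a : α => imp (lift (a ∈ D A)) (mem a S))

/-- The sentence that `𝒰`, a family of subsets of `α` in the extension, is an ultrafilter on `α`. -/
def isUltrafilter (𝒰 : Name P α → Sentence P) : Sentence P :=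
  and (all fun S : Name P α => imp (𝒰 S) (ex fun a : α => mem a S)) <|
  and (all fun S : Name P α => all fun T : Name P α => all fun R : Name P α =>
    imp (and (and (𝒰 S) (𝒰 T)) (all fun a : α => imp (and (mem a S) (mem a T)) (mem a R))) (𝒰 R)) <|
  all fun S : Name P α =>
    or (𝒰 S) (ex fun T : Name P α => and (𝒰 T) (all fun a : α => imp (mem a T) (not (mem a S))))

/-- The set `[α]^m` of `m`-element subsets of `α`. -/
abbrev Subsets (α : Type*) (m : ℕ) := {s : Finset α // s.card = m}

/-- The sentence that `c` is a colouring of `[α]^m` with `l` colours, that is (the graph of) a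
function from `[α]^m` to `l = {0, …, l - 1}`. -/
def isColouring {m l : ℕ} (c : Name P (Subsets α m × Fin l)) : Sentence P :=
  all fun s : Subsets α m => ex fun i : Fin l =>
    and (mem (s, i) c) (all fun i' : Fin l => imp (mem (s, i') c) (lift (i' = i)))

/-- The sentence that the restriction of `c` to `[X]^m` takes no more than `t` colours. -/
def takesAtMost {m l : ℕ} (t : ℕ) (c : Name P (Subsets α m × Fin l)) (X : Name P α) : Sentence P :=
  ex fun K : Finset (Fin l) => and (lift (K.card ≤ t)) <|
    all fun s : Subsets α m => imp (all fun a : α => imp (lift (a ∈ s.1)) (mem a X)) <|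
      all fun i : Fin l => imp (mem (s, i) c) (lift (i ∈ K))

/-- The sentence: for all `l ≥ 2` and all colourings `c : [α]^m → l` there is `X ∈ 𝒰` such that
the restriction of `c` to `[X]^m` takes no more than `t` colours. -/
def partitionRelation (𝒰 : Name P α → Sentence P) (m t : ℕ) : Sentence P :=
  all fun l : ℕ => imp (lift (2 ≤ l)) <|
    all fun c : Name P (Subsets α m × Fin l) => imp (isColouring c) <|
      ex fun X : Name P α => and (𝒰 X) (takesAtMost t c X)

/-- The sentence that `𝒰` is an ultrafilter on `α` with Ramsey degree `t(𝒰, m) = t`, that is,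
`t` is the least number for which `partitionRelation` holds. -/
def ramseyDegreeEq (𝒰 : Name P α → Sentence P) (m t : ℕ) : Sentence P :=
  and (isUltrafilter 𝒰) <| and (partitionRelation 𝒰 m t) <|
    all fun t' : ℕ => imp (lift (t' < t)) (not (partitionRelation 𝒰 m t'))

end Names

end Forcing

/-! ### The hypercube spaces -/

namespace Hypercube

variable {n : ℕ} {L : Fin n → Type*} [∀ j, LinearOrder (L j)]

/-- `A k j` (with the order induced from `L j`) is the finite linear order `A_{k,j}`; every
generating sequence from the class of finite linear orders is of this form, where `L j` is the
union of the chain `A_{0,j} ⊆ A_{1,j} ⊆ …`. The last field says that every finite linear order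
embeds into some `A_{k,j}`. The Ramsey property
`∀ k < m, ∃ N > m, A_{N,j} → (A_{m,j})^{A_{k,j}}` then holds by the finite Ramsey theorem and
is not required separately. -/
structure IsGeneratingSequence (A : ℕ → (j : Fin n) → Finset (L j)) : Prop where
  card_zero : ∀ j, (A 0 j).card = 1
  subset_succ : ∀ k j, A k j ⊆ A (k + 1) j
  exists_embedding : ∀ j (m : ℕ), ∃ k, Nonempty (Fin m ↪o ↥(A k j))

/-- Members `B = ⟨⟨n_k, B_k⟩ : k < ω⟩` of the space generated by `A`: `idx k` is `n_k` and
`str k` is the `n`-tuple `B_k = (B_{k,j})_{j < n}`. -/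
structure Space (A : ℕ → (j : Fin n) → Finset (L j)) where
  idx : ℕ → ℕ
  idx_strictMono : StrictMono idx
  str : ℕ → (j : Fin n) → Finset (L j)
  str_subset : ∀ k j, str k j ⊆ A (idx k) j
  str_iso : ∀ k j, Nonempty (↥(str k j) ≃o ↥(A k j))

variable {A : ℕ → (j : Fin n) → Finset (L j)}

/-- The `k`-th block `B(k) = ⟨n_k, B_k⟩`. -/
def Space.block (B : Space A) (k : ℕ) : ℕ × ((j : Fin n) → Finset (L j)) := (B.idx k, B.str k)

/-- The order `C ≤ B` of the space: each block of `C` has the same index as some block of `B` and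
is a substructure of it. -/
def Space.Reduction (C B : Space A) : Prop :=
  ∀ k, ∃ l, C.idx k = B.idx l ∧ ∀ j, C.str k j ⊆ B.str l j

variable (A) in
/-- The set `AR₁` of first approximations `r₁(B) = ⟨B(0)⟩`; the one-term sequence `⟨B(0)⟩` is
identified with its term. -/
def AR1 := {a : ℕ × ((j : Fin n) → Finset (L j)) // ∃ B : Space A, B.block 0 = a}

/-- The set `AR₁ ↾ X` of first approximations of the members of the space below `X`. -/
def Space.firsts (X : Space A) : Set (AR1 A) := {a | ∃ Y : Space A, Y.Reduction X ∧ Y.block 0 = a.1}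

/-- The order `≤*`, which is inclusion modulo finite sets: `X ≤* Y` if and only if all but
finitely many elements of `AR₁ ↾ X` belong to `AR₁ ↾ Y`. -/
instance : Preorder (Space A) where
  le X Y := (X.firsts \ Y.firsts).Finite
  le_refl X := by simp
  le_trans X Y Z h₁ h₂ := (h₁.union h₂).subset fun a ha => by
    by_cases h : a ∈ Y.firsts
    · exact Or.inr ⟨h, ha.2⟩
    · exact Or.inl ⟨ha.1, h⟩

/-- `S ∈ 𝒱_n`, for the filter `𝒱_n` on `AR₁` generated by the sets `AR₁ ↾ X`, where `X` belongs
to the generic filter for `≤*`. -/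
def memUltrafilter (S : Forcing.Name (Space A) (AR1 A)) : Forcing.Sentence (Space A) :=
  Forcing.memGenerated Space.firsts S

end Hypercube

/-! ### Blass' square forcing -/

namespace Blass

/-- Conditions of Blass' square forcing: subsets of `ω × ω` that contain, for every `m`, an
`m`-square, that is, a set `s × t` with `|s| = |t| = m`; they are ordered by inclusion. -/
def SquareForcing :=
  {X : Set (ℕ × ℕ) // ∀ m : ℕ, ∃ s t : Finset ℕ, s.card = m ∧ t.card = m ∧ (s : Set ℕ) ×ˢ (t : Set ℕ) ⊆ X}

instance : Preorder SquareForcing := Preorder.lift Subtype.val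

/-- `S` belongs to the filter on `ω × ω` generated by the generic filter. -/
def memUltrafilter (S : Forcing.Name SquareForcing (ℕ × ℕ)) : Forcing.Sentence SquareForcing :=
  Forcing.memGenerated (fun X : SquareForcing => X.1) S

end Blass

/-! ### Product Ramsey theorem for pairs -/

namespace Cube

/-! Both forcings amount to forcing with the large subsets of a countable set, those that contain
finite `n`-cubes of every size (`System`, `Represents`). By a product Ramsey theorem largeness is
partition regular, and diagonalising along a decreasing sequence of conditions lets one condition
decide countably many questions. Hence names for subsets and for colourings of pairs reduce to
ground-model objects, and the theorem becomes a statement about large sets.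

Upper bound (`Large.exists_few_colours`): take an ultrafilter of large sets and pick cubes one after
another, so that pairs from different cubes all get one limit colour, while inside a cube the colour
depends only on the vector of signs comparing coordinates. Unordered pairs see nonzero sign vectors
up to negation, of which there are `(3 ^ n - 1) / 2 = ∑ i < n, 3 ^ i`; balanced ternary numbers
them.

Lower bound (`forced_ramseyDegreeEq_of_positions`): colour related pairs by sign vector up to
negation and unrelated pairs by one further colour. Every large set realises all of these. On `AR1`,
related means on the same level; on `ω × ω`, it means that neither point is `Far` from the other. -/

theorem exists_end_homogeneous (κ : Type*) [Fintype κ] (r : ℕ) :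
    ∃ N : ℕ, ∀ (α : Type) [LinearOrder α] (c : α → α → κ) (s : Finset α), N ≤ s.card →
      ∃ t ⊆ s, t.card = r ∧ ∃ d : α → κ, ∀ x ∈ t, ∀ y ∈ t, x < y → c x y = d x := by
  classical
  induction r with
  | zero => exact ⟨0, fun α _ c s _ => ⟨∅, by simp, by simp, fun x => c x x, by simp⟩⟩
  | succ r ih =>
    obtain ⟨N, hN⟩ := ih
    -- The `1` pays for the least element `x`; the other elements split by `c x` into `card κ`
    -- classes, one of size at least `N`.
    refine ⟨Fintype.card κ * N + 1, fun α _ c s hs => ?_⟩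
    have hne : s.Nonempty := Finset.card_pos.1 (by omega)
    set x := s.min' hne
    have hx : x ∈ s := s.min'_mem hne
    obtain ⟨k, -, hk⟩ := Finset.exists_le_card_fiber_of_mul_le_card_of_maps_to
      (s := s.erase x) (t := Finset.univ) (f := c x) (n := N) (fun _ _ => Finset.mem_univ _)
      ⟨c x x, Finset.mem_univ _⟩ (by rw [Finset.card_erase_of_mem hx, Finset.card_univ]; omega)
    obtain ⟨t, hts, htc, d, hd⟩ := hN α c _ hk
    have hmem : ∀ y ∈ t, y ≠ x ∧ y ∈ s ∧ c x y = k := fun y hy => by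
      have := hts hy
      simp only [Finset.mem_filter, Finset.mem_erase] at this
      exact ⟨this.1.1, this.1.2, this.2⟩
    have hxt : x ∉ t := fun h => (hmem x h).1 rfl
    refine ⟨insert x t, ?_, by rw [Finset.card_insert_of_notMem hxt, htc],
      Function.update d x k, ?_⟩
    · intro y hy
      rcases Finset.mem_insert.1 hy with rfl | hy
      exacts [hx, (hmem y hy).2.1]
    · intro y hy z hz hyz
      rcases Finset.mem_insert.1 hy with rfl | hy
      · rcases Finset.mem_insert.1 hz with rfl | hz
        · exact absurd hyz (lt_irrefl _)
        · rw [Function.update_self, (hmem z hz).2.2]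
      · rcases Finset.mem_insert.1 hz with rfl | hz
        · exact absurd hyz (s.min'_le y (hmem y hy).2.1).not_gt
        · rw [Function.update_of_ne (hmem y hy).1, hd y hy z hz hyz]

/-- The finite Ramsey theorem for pairs. -/
theorem exists_pair_ramsey (κ : Type*) [Finite κ] (m : ℕ) :
    ∃ N : ℕ, ∀ c : Fin N → Fin N → κ, ∃ x : Fin m → Fin N, StrictMono x ∧
      ∃ k, ∀ p q, p < q → c (x p) (x q) = k := by
  classical
  have := Fintype.ofFinite κ
  obtain ⟨N, hN⟩ := exists_end_homogeneous κ (Fintype.card κ * (m + 1))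
  -- The successor provides `0`, so that `c 0 0` shows that `κ` is inhabited.
  refine ⟨N + 1, fun c => ?_⟩
  obtain ⟨t, -, htc, d, hd⟩ := hN (Fin (N + 1)) c Finset.univ (by simp)
  obtain ⟨k, -, hk⟩ := Finset.exists_le_card_fiber_of_mul_le_card_of_maps_to
    (s := t) (t := Finset.univ) (f := d) (n := m + 1) (fun _ _ => Finset.mem_univ _)
    ⟨c 0 0, Finset.mem_univ _⟩ (by rw [htc, Finset.card_univ])
  obtain ⟨u, hut, huc⟩ := Finset.exists_subset_card_eq (show m ≤ _ from (Nat.le_succ m).trans hk)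
  have hu : ∀ i, u.orderEmbOfFin huc i ∈ t ∧ d (u.orderEmbOfFin huc i) = k := fun i =>
    Finset.mem_filter.1 (hut (u.orderEmbOfFin_mem huc i))
  refine ⟨u.orderEmbOfFin huc, (u.orderEmbOfFin huc).strictMono, k, fun p q hpq => ?_⟩
  rw [hd _ (hu p).1 _ (hu q).1 ((u.orderEmbOfFin huc).strictMono hpq), (hu p).2]

/-- The finite product Ramsey theorem for pairs in each coordinate. -/
theorem exists_prod_ramsey (n : ℕ) (κ : Type*) [Finite κ] (m : ℕ) :
    ∃ N : ℕ, ∀ c : (Fin n → Fin N × Fin N) → κ,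
      ∃ x : Fin n → Fin m → Fin N, (∀ j, StrictMono (x j)) ∧
        ∃ k, ∀ p q : Fin n → Fin m, (∀ j, p j < q j) → c (fun j => (x j (p j), x j (q j))) = k := by
  induction n with
  | zero =>
    exact ⟨0, fun c => ⟨finZeroElim, finZeroElim, c finZeroElim,
      fun p q _ => congrArg c (Subsingleton.elim _ _)⟩⟩
  | succ n ih =>
    obtain ⟨N₁, h₁⟩ := ih
    -- A pair in the first coordinate is coloured by the whole colouring it induces on the remaining
    -- coordinates.
    obtain ⟨N₂, h₂⟩ := exists_pair_ramsey ((Fin n → Fin N₁ × Fin N₁) → κ) m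
    let i₁ : Fin N₁ → Fin (max N₁ N₂) := Fin.castLE (le_max_left _ _)
    let i₂ : Fin N₂ → Fin (max N₁ N₂) := Fin.castLE (le_max_right _ _)
    refine ⟨max N₁ N₂, fun c => ?_⟩
    obtain ⟨y, hy, f, hf⟩ := h₂ fun a b g =>
      c (Fin.cons (i₂ a, i₂ b) fun j => (i₁ (g j).1, i₁ (g j).2))
    obtain ⟨x, hx, k, hk⟩ := h₁ f
    refine ⟨Fin.cons (i₂ ∘ y) fun j => i₁ ∘ x j, ?_, k, fun p q hpq => ?_⟩
    · refine Fin.cases ?_ fun j => ?_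
      · exact (Fin.strictMono_castLE (le_max_right N₁ N₂)).comp hy
      · exact (Fin.strictMono_castLE (le_max_left N₁ N₂)).comp (hx j)
    · rw [← hk (fun j => p j.succ) (fun j => q j.succ) (fun j => hpq j.succ),
        ← hf (p 0) (q 0) (hpq 0)]
      congr 1
      funext j
      refine Fin.cases ?_ (fun j => ?_) j <;> simp

/-! ### Sign types -/

/-- The relative position of two elements of a linear order. -/
def cmpSign {α : Type*} [LinearOrder α] (a b : α) : SignType :=
  if a < b then 1 else if b < a then -1 else 0

section cmpSign

variable {α β : Type*} [LinearOrder α] [LinearOrder β]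

theorem cmpSign_swap (a b : α) : cmpSign b a = -cmpSign a b := by
  rcases lt_trichotomy a b with h | h | h
  · simp [cmpSign, h, h.not_gt]
  · simp [cmpSign, h]
  · simp [cmpSign, h, h.not_gt]

theorem cmpSign_eq_zero {a b : α} : cmpSign a b = 0 ↔ a = b := by
  rcases lt_trichotomy a b with h | h | h
  · simp [cmpSign, h, h.ne]
  · simp [cmpSign, h]
  · simp [cmpSign, h, h.not_gt, h.ne']

theorem _root_.StrictMono.cmpSign_eq {f : α → β} (hf : StrictMono f) (a b : α) :
    cmpSign (f a) (f b) = cmpSign a b := by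
  simp [cmpSign, hf.lt_iff_lt]

theorem exists_cmpSign_eq {a b : α} (h : a < b) (s : SignType) :
    ∃ x y, (x = a ∨ x = b) ∧ (y = a ∨ y = b) ∧ cmpSign x y = s := by
  cases s with
  | zero => exact ⟨a, a, by simp, by simp, by simp [cmpSign]⟩
  | neg => exact ⟨b, a, by simp, by simp, by simp [cmpSign, h, h.not_gt]⟩
  | pos => exact ⟨a, b, by simp, by simp, by simp [cmpSign, h]⟩

end cmpSign

/-- In a large finite cube, every colouring of the pairs of points agrees, on a subcube of
prescribed size, with a function of the relative position. -/
theorem exists_type_ramsey (n : ℕ) (κ : Type*) [Finite κ] (m : ℕ) :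
    ∃ N : ℕ, ∀ c : (Fin n → Fin N) → (Fin n → Fin N) → κ,
      ∃ x : Fin n → Fin m → Fin N, (∀ j, StrictMono (x j)) ∧
        ∃ g : (Fin n → SignType) → κ, ∀ v w : Fin n → Fin m,
          c (fun j => x j (v j)) (fun j => x j (w j)) = g fun j => cmpSign (v j) (w j) := by
  -- The colour of a tuple of increasing pairs records the colours of all point pairs built from it,
  -- one for each sign vector. The extra top element serves as the larger partner where `v j = w j`;
  -- its value is then never read.
  obtain ⟨N, hN⟩ := exists_prod_ramsey n ((Fin n → SignType) → κ) (m + 1)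
  refine ⟨N, fun c => ?_⟩
  obtain ⟨x, hx, g, hg⟩ := hN fun f τ =>
    c (fun j => if τ j = -1 then (f j).2 else (f j).1) (fun j => if τ j = 1 then (f j).2 else (f j).1)
  refine ⟨fun j i => x j i.castSucc, fun j => (hx j).comp Fin.strictMono_castSucc, g,
    fun v w => ?_⟩
  rw [← hg (fun j => (min (v j) (w j)).castSucc)
    (fun j => if v j = w j then Fin.last m else (max (v j) (w j)).castSucc)]
  · have key : ∀ j, x j (v j).castSucc = (if cmpSign (v j) (w j) = -1 then
          x j (if v j = w j then Fin.last m else (max (v j) (w j)).castSucc)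
          else x j (min (v j) (w j)).castSucc) ∧
        x j (w j).castSucc = (if cmpSign (v j) (w j) = 1 then
          x j (if v j = w j then Fin.last m else (max (v j) (w j)).castSucc)
          else x j (min (v j) (w j)).castSucc) := fun j => by
      rcases lt_trichotomy (v j) (w j) with h | h | h
      · simp [cmpSign, h, h.ne, h.le]
      · simp [cmpSign, h]
      · simp [cmpSign, h, h.ne', h.le, h.not_gt]
    simp only [← (key _).1, ← (key _).2]
  · intro j
    split_ifs with h
    · exact Fin.castSucc_lt_last _
    · rw [Fin.castSucc_lt_castSucc_iff]
      exact min_lt_max.2 h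

/-! ### Balanced ternary expansions -/

/-- The integer with given digits in balanced ternary. -/
def balanced {n : ℕ} (τ : Fin n → SignType) : ℤ := ∑ j, (τ j : ℤ) * 3 ^ (j : ℕ)

theorem balanced_succ {n : ℕ} (τ : Fin (n + 1) → SignType) :
    balanced τ = τ 0 + 3 * balanced fun j => τ j.succ := by
  simp only [balanced, Fin.sum_univ_succ, Finset.mul_sum, Fin.val_zero, pow_zero, mul_one,
    Fin.val_succ]
  congr 1
  exact Finset.sum_congr rfl fun j _ => by ring

/-- Swapping the points of a pair negates its sign vector, so with injectivity `(balanced τ).natAbs`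
is a complete invariant of the unordered position. -/
theorem balanced_neg {n : ℕ} (τ : Fin n → SignType) : balanced (-τ) = -balanced τ := by
  simp [balanced]

theorem signType_cast_cases (s : SignType) :
    s = 0 ∧ (s : ℤ) = 0 ∨ s = 1 ∧ (s : ℤ) = 1 ∨ s = -1 ∧ (s : ℤ) = -1 := by
  cases s <;> decide

/-- The residue modulo 3 determines the lowest digit. -/
theorem balanced_injective (n : ℕ) : Function.Injective (balanced (n := n)) := by
  induction n with
  | zero => exact fun _ _ _ => Subsingleton.elim _ _
  | succ n ih =>
    intro τ σ h
    rw [balanced_succ, balanced_succ] at h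
    have h0 : τ 0 = σ 0 ∧ balanced (fun j => τ j.succ) = balanced fun j => σ j.succ := by
      rcases signType_cast_cases (τ 0) with ⟨a, b⟩ | ⟨a, b⟩ | ⟨a, b⟩ <;>
      rcases signType_cast_cases (σ 0) with ⟨a', b'⟩ | ⟨a', b'⟩ | ⟨a', b'⟩ <;>
      first
      | exact ⟨a.trans a'.symm, by omega⟩
      | omega
    have h1 := ih h0.2
    funext j
    exact Fin.cases h0.1 (fun j => congrFun h1 j) j

theorem sum_three_pow_succ (n : ℕ) :
    ∑ i ∈ Finset.range (n + 1), 3 ^ i = 1 + 3 * ∑ i ∈ Finset.range n, 3 ^ i := by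
  rw [Finset.sum_range_succ', Finset.mul_sum, add_comm]
  simp [pow_succ']

theorem natAbs_balanced_le {n : ℕ} (τ : Fin n → SignType) :
    (balanced τ).natAbs ≤ ∑ i ∈ Finset.range n, 3 ^ i := by
  induction n with
  | zero => simp [balanced]
  | succ n ih =>
    have := ih fun j => τ j.succ
    rw [balanced_succ, sum_three_pow_succ]
    rcases signType_cast_cases (τ 0) with h | h | h <;> omega

theorem exists_balanced_eq {n : ℕ} (z : ℤ) (hz : z.natAbs ≤ ∑ i ∈ Finset.range n, 3 ^ i) :
    ∃ τ : Fin n → SignType, balanced τ = z := by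
  induction n generalizing z with
  | zero => exact ⟨0, by simp at hz; simp [balanced, hz]⟩
  | succ n ih =>
    rw [sum_three_pow_succ] at hz
    obtain ⟨s, w, hs⟩ : ∃ (s : SignType) (w : ℤ), z = s + 3 * w := by
      have : z % 3 = 0 ∨ z % 3 = 1 ∨ z % 3 = 2 := by omega
      rcases this with h | h | h
      · exact ⟨0, z / 3, by simp; omega⟩
      · exact ⟨1, z / 3, by simp; omega⟩
      · exact ⟨-1, z / 3 + 1, by simp; omega⟩
    obtain ⟨τ, hτ⟩ := ih w (by
      rcases signType_cast_cases s with h | h | h <;> omega)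
    exact ⟨Fin.cons s τ, by rw [balanced_succ]; simp [hτ, hs]⟩

theorem balanced_eq_zero {n : ℕ} {τ : Fin n → SignType} : balanced τ = 0 ↔ τ = 0 := by
  have : balanced (0 : Fin n → SignType) = 0 := by simp [balanced]
  rw [← this, (balanced_injective n).eq_iff]

end Cube

/-! ### Systems of finite cubes -/

namespace Cube

/-- A family of injective images in `α` of the finite `n`-dimensional cubes `(Fin n → Fin m)`,
closed under passing to subcubes. -/
structure System (α : Type*) (n : ℕ) where
  IsCube : ∀ m : ℕ, ((Fin n → Fin m) → α) → Prop
  injective : ∀ {m e}, IsCube m e → Function.Injective e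
  comp : ∀ {N m e} {x : Fin n → Fin m → Fin N}, IsCube N e → (∀ j, StrictMono (x j)) →
    IsCube m fun v => e fun j => x j (v j)

namespace System

variable {α : Type*} {n : ℕ} (E : System α n)

/-- A set is large if it contains cubes of all finite sizes. -/
def Large (S : Set α) : Prop := ∀ m, ∃ e, E.IsCube m e ∧ ∀ v, e v ∈ S

variable {E}

theorem Large.mono {S T : Set α} (hS : E.Large S) (h : S ⊆ T) : E.Large T := fun m =>
  (hS m).imp fun _ he => ⟨he.1, fun v => h (he.2 v)⟩

theorem exists_cube_of_le {S : Set α} {m N : ℕ} (h : m ≤ N)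
    (hN : ∃ e, E.IsCube N e ∧ ∀ v, e v ∈ S) : ∃ e, E.IsCube m e ∧ ∀ v, e v ∈ S := by
  obtain ⟨e, he, heS⟩ := hN
  exact ⟨_, E.comp he fun _ => Fin.strictMono_castLE h, fun v => heS _⟩

theorem Large.or_of_union {S T : Set α} (h : E.Large (S ∪ T)) : E.Large S ∨ E.Large T := by
  by_contra! hST
  simp only [Large, not_forall] at hST
  obtain ⟨⟨m₁, h₁⟩, m₂, h₂⟩ := hST
  obtain ⟨N, hN⟩ := exists_type_ramsey n Prop (max m₁ m₂)
  obtain ⟨e, he, heS⟩ := h N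
  -- A colouring of points is a colouring of pairs that ignores the second point; on the diagonal
  -- the position is `0`, so the subcube lies wholly inside or outside `S`.
  obtain ⟨x, hx, g, hg⟩ := hN fun v _ => e v ∈ S
  have hg' : ∀ v : Fin n → Fin (max m₁ m₂), (e (fun j => x j (v j)) ∈ S) = g 0 := fun v => by
    rw [hg v v]
    exact congrArg g (funext fun j => cmpSign_eq_zero.2 rfl)
  by_cases hg0 : g 0
  · exact h₁ (exists_cube_of_le (le_max_left _ _) ⟨_, E.comp he hx, fun v => by rwa [hg' v]⟩)
  · exact h₂ (exists_cube_of_le (le_max_right m₁ _) ⟨_, E.comp he hx, fun v =>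
      (heS _).resolve_left (by rwa [hg' v])⟩)

section NeZero

variable [NeZero n]

theorem Large.infinite {S : Set α} (hS : E.Large S) : S.Infinite := by
  intro hfin
  obtain ⟨e, he, heS⟩ := hS (hfin.toFinset.card + 1)
  have := Finset.card_le_card_of_injOn (s := Finset.univ) (t := hfin.toFinset)
    (fun i : Fin (hfin.toFinset.card + 1) => e fun _ => i)
    (fun i _ => by simpa using heS _)
    fun i _ k _ hik => congrFun (E.injective he hik) 0
  simp at this

theorem Large.diff_finite {S F : Set α} (hS : E.Large S) (hF : F.Finite) : E.Large (S \ F) := by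
  rcases (hS.mono (show S ⊆ (S \ F) ∪ F by simp)).or_of_union with h | h
  exacts [h, absurd hF h.infinite]

theorem Large.inter_of_diff_finite {S T : Set α} (hS : E.Large S) (h : (S \ T).Finite) :
    E.Large (S ∩ T) := by
  simpa using hS.diff_finite h

/-- Every large set belongs to an ultrafilter that consists of large sets. -/
theorem Large.exists_ultrafilter {X : Set α} (hX : E.Large X) :
    ∃ u : Ultrafilter α, X ∈ u ∧ ∀ S ∈ u, E.Large S := by
  -- The filter of sets whose complement in `X` is not large; partition regularity gives closure
  -- under intersection. If `S` is not large then `Sᶜ ∈ F`, so no ultrafilter above `F` contains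
  -- `S`.
  let F : Filter α :=
    { sets := {S | ¬ E.Large (X \ S)}
      univ_sets := fun h => h.infinite (by simp)
      sets_of_superset := fun {S T} hS hST h => hS (h.mono (Set.sdiff_subset_sdiff_right hST))
      inter_sets := fun {S T} hS hT h => by
        rw [Set.sdiff_inter] at h
        exact h.or_of_union.elim hS hT }
  have hmem : ∀ S, S ∈ F ↔ ¬ E.Large (X \ S) := fun S => Iff.rfl
  have : F.NeBot := ⟨fun h => by
    have := (hmem ∅).1 (by simp [h])
    simp [hX] at this⟩
  refine ⟨Ultrafilter.of F, Ultrafilter.of_le F ?_, fun S hS => ?_⟩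
  · rw [hmem]
    exact fun h => h.infinite (by simp)
  · by_contra hL
    have : Sᶜ ∈ F := (hmem _).2 fun h => hL (h.mono fun a ha => by simpa using ha.2)
    exact Ultrafilter.compl_notMem_iff.2 hS (Ultrafilter.of_le F this)

end NeZero

/-- One `g` serves all `S` and `m`: there are finitely many `g`, and if each failed for some `S g`
and `m g`, a large cube in the intersection of the `S g` would contradict the Ramsey theorem. -/
theorem exists_homogeneous_cubes {κ : Type*} [Finite κ] {u : Ultrafilter α}
    (hu : ∀ S ∈ u, E.Large S) (c : α → α → κ) :
    ∃ g : (Fin n → SignType) → κ, ∀ S ∈ u, ∀ m, ∃ e, E.IsCube m e ∧ (∀ v, e v ∈ S) ∧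
      ∀ v w, c (e v) (e w) = g fun j => cmpSign (v j) (w j) := by
  have := Fintype.ofFinite ((Fin n → SignType) → κ)
  by_contra! h
  choose S hS m hm using h
  obtain ⟨N, hN⟩ := exists_type_ramsey n κ (Finset.univ.sup m)
  obtain ⟨e, he, heS⟩ := hu (⋂ g, S g) (Filter.iInter_mem.2 hS) N
  obtain ⟨x, hx, g, hg⟩ := hN fun v w => c (e v) (e w)
  have hle : m g ≤ Finset.univ.sup m := Finset.le_sup (Finset.mem_univ g)
  obtain ⟨v, w, hvw⟩ := hm g _ (E.comp (E.comp he hx) fun _ => Fin.strictMono_castLE hle)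
    fun v => Set.mem_iInter.1 (heS _) g
  exact hvw (hg _ _)

/-- Every large set has a large subset whose pairs receive few colours. -/
theorem Large.exists_few_colours [NeZero n] {κ : Type*} [Finite κ] {X : Set α} (hX : E.Large X)
    (c : α → α → κ) (hc : ∀ x y, c x y = c y x) :
    ∃ S ⊆ X, E.Large S ∧ ∃ K : Finset κ, K.card ≤ 1 + ∑ i ∈ Finset.range n, 3 ^ i ∧
      ∀ x ∈ S, ∀ y ∈ S, x ≠ y → c x y ∈ K := by
  classical
  obtain ⟨u, hXu, hu⟩ := hX.exists_ultrafilter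
  have hlim : ∀ f : α → κ, ∃ k, {x | f x = k} ∈ u := fun f => by
    obtain ⟨k, hk⟩ := (u.map f).eq_pure_of_finite
    have : ({k} : Set κ) ∈ u.map f := by rw [hk]; exact Filter.mem_pure.2 rfl
    exact ⟨k, this⟩
  -- `f x` is the limit of `c x y` as `y` tends to `u`, and `k₀` is the limit of `f`. Each new cube
  -- is taken where `f = k₀` and where `c a` already equals `f a` for every earlier vertex `a`.
  choose f hf using fun x => hlim (c x)
  obtain ⟨k₀, hk₀⟩ := hlim f
  obtain ⟨g, hg⟩ := exists_homogeneous_cubes hu c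
  obtain ⟨F, hF, hFF⟩ := exists_seq_of_forall_finset_exists
    (fun e : Σ m, ((Fin n → Fin m) → α) => E.IsCube e.1 e.2 ∧
      (∀ v, e.2 v ∈ X ∩ {x | f x = k₀}) ∧
      ∀ v w, c (e.2 v) (e.2 w) = g fun j => cmpSign (v j) (w j))
    (fun e e' => e.1 < e'.1 ∧ ∀ v w, c (e.2 v) (e'.2 w) = f (e.2 v)) (by
      intro s hs
      obtain ⟨e, he, heS, heg⟩ := hg ((X ∩ {x | f x = k₀}) ∩
        ⋂ e' ∈ s, ⋂ v, {y | c (e'.2 v) y = f (e'.2 v)})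
        (Filter.inter_mem (Filter.inter_mem hXu hk₀) ((Filter.biInter_finset_mem s).2
          fun e' _ => Filter.iInter_mem.2 fun v => hf _)) (s.sup Sigma.fst + 1)
      refine ⟨⟨_, e⟩, ⟨he, fun v => (heS v).1, heg⟩, fun e' he' =>
        ⟨Nat.lt_succ_of_le (Finset.le_sup (f := Sigma.fst) he'), fun v w => ?_⟩⟩
      exact Set.mem_iInter.1 (Set.mem_iInter₂.1 (heS w).2 e' he') v)
  have hsize : ∀ m, m ≤ (F m).1 :=
    (strictMono_nat_of_lt_succ fun m => (hFF m (m + 1) (Nat.lt_succ_self m)).1).id_le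
  have hτ : ∀ k : ℕ, ∃ τ : Fin n → SignType, k ≤ ∑ i ∈ Finset.range n, 3 ^ i → balanced τ = k :=
    fun k => by
      by_cases h : k ≤ ∑ i ∈ Finset.range n, 3 ^ i
      · exact (exists_balanced_eq (k : ℤ) (by simpa using h)).imp fun _ h _ => h
      · exact ⟨0, fun h' => absurd h' h⟩
  choose τ hτ using hτ
  refine ⟨{a | ∃ m v, (F m).2 v = a}, ?_, fun m => ?_,
    insert k₀ ((Finset.Icc 1 (∑ i ∈ Finset.range n, 3 ^ i)).image fun k => g (τ k)), ?_, ?_⟩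
  · rintro a ⟨m, v, rfl⟩
    exact ((hF m).2.1 v).1
  · exact exists_cube_of_le (hsize m) ⟨_, (hF m).1, fun v => ⟨m, v, rfl⟩⟩
  · refine (Finset.card_insert_le _ _).trans ?_
    rw [add_comm]
    gcongr
    exact Finset.card_image_le.trans (by simp)
  · have hlt : ∀ m m', m < m' → ∀ v w, c ((F m).2 v) ((F m').2 w) = k₀ := fun m m' h v w =>
      ((hFF m m' h).2 v w).trans ((hF m).2.1 v).2
    rintro _ ⟨m, v, rfl⟩ _ ⟨m', w, rfl⟩ hne
    rcases lt_trichotomy m m' with h | rfl | h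
    · rw [hlt m m' h]
      exact Finset.mem_insert_self _ _
    · refine Finset.mem_insert_of_mem (Finset.mem_image.2 ?_)
      set σ : Fin n → SignType := fun j => cmpSign (v j) (w j) with hσ
      have h0 : balanced σ ≠ 0 := fun h => hne <| congrArg _ <| funext fun j =>
        cmpSign_eq_zero.1 (congrFun (balanced_eq_zero.1 h) j)
      have hle := natAbs_balanced_le σ
      refine ⟨(balanced σ).natAbs, Finset.mem_Icc.2 ⟨by omega, hle⟩, ?_⟩
      have hb := hτ _ hle
      rcases Int.natAbs_eq (balanced σ) with h | h
      · rw [balanced_injective n (hb.trans h.symm), (hF m).2.2]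
      -- The chosen representative is the opposite sign vector, that of the swapped pair, which has
      -- the same colour by symmetry.
      · have : τ (balanced σ).natAbs = -σ := balanced_injective n <| by
          rw [hb, balanced_neg]; omega
        rw [this, hc, (hF m).2.2]
        congr 1
        funext j
        exact (cmpSign_swap _ _).symm
    · rw [hc, hlt m' m h]
      exact Finset.mem_insert_self _ _

end System

end Cube

/-! ### Forcing with large sets -/

namespace Forcing

section Monotone

variable {P : Type*} [Preorder P] {α : Type*} {p q : P}

theorem mem_of_le {a : α} {S : Name P α} (hp : mem a S p) (h : q ≤ p) : mem a S q :=
  fun r hr => hp r (hr.trans h)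

theorem mem_of_dense {a : α} {S : Name P α} (h : ∀ q ≤ p, ∃ r ≤ q, mem a S r) : mem a S p :=
  fun q hq => by
    obtain ⟨r, hr, hm⟩ := h q hq
    obtain ⟨r', hr', hs⟩ := hm r le_rfl
    exact ⟨r', hr'.trans hr, hs⟩

theorem mem_of_mem {a : α} {S : Name P α} {s : P} (ha : (a, s) ∈ S) (h : p ≤ s) : mem a S p :=
  fun q hq => ⟨q, le_rfl, s, ha, hq.trans h⟩

/-- The canonical name of a ground-model set. -/
def check (S : Set α) : Name P α := {x | x.1 ∈ S}

theorem mem_check {a : α} {S : Set α} : mem a (check S) p ↔ a ∈ S := by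
  constructor
  · intro h
    obtain ⟨r, -, s, hs, -⟩ := h p le_rfl
    exact hs
  · intro h
    exact mem_of_mem (s := p) h le_rfl

theorem not_mem_of_dense {a : α} {S : Name P α} (h : ∀ q ≤ p, ∃ r ≤ q, not (mem a S) r) :
    not (mem a S) p := fun q hq hm => by
  obtain ⟨r, hr, hn⟩ := h q hq
  exact hn r le_rfl (mem_of_le hm hr)

theorem memGenerated_of_le {D : P → Set α} {S : Name P α} (hp : memGenerated D S p) (h : q ≤ p) :
    memGenerated D S q := fun r hr => hp r (hr.trans h)

end Monotone

end Forcing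

namespace Cube.System

open Forcing

variable {P α : Type*} [Preorder P] {n : ℕ}

/-- The forcing `P` is, up to equivalence, the forcing with large sets, where `D p` is the large
set that corresponds to the condition `p`. -/
structure Represents (E : System α n) (D : P → Set α) : Prop where
  le_of_subset : ∀ {r p}, D r ⊆ D p → r ≤ p
  finite_diff : ∀ {r p}, r ≤ p → (D r \ D p).Finite
  large_iff : ∀ S, E.Large S ↔ ∃ p, D p ⊆ S

namespace Represents

variable {E : System α n} {D : P → Set α} (hD : E.Represents D)
include hD

theorem large (p : P) : E.Large (D p) := (hD.large_iff _).2 ⟨p, subset_rfl⟩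

/-- The union of an `m`-cube from each `D (p m)` is large, and only its cubes with `m < k` can leave
`D (p k)`. -/
theorem exists_pseudo_intersection (p : ℕ → P) (hp : ∀ k, D (p (k + 1)) ⊆ D (p k)) :
    ∃ r, D r ⊆ D (p 0) ∧ ∀ k, (D r \ D (p k)).Finite := by
  choose e he using fun m => hD.large (p m) m
  have hanti : Antitone fun k => D (p k) := antitone_nat_of_succ_le hp
  obtain ⟨r, hr⟩ := (hD.large_iff (⋃ m, Set.range (e m))).1 fun m =>
    ⟨e m, (he m).1, fun v => Set.mem_iUnion.2 ⟨m, v, rfl⟩⟩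
  refine ⟨r, fun a ha => ?_, fun k => ?_⟩
  · obtain ⟨m, v, rfl⟩ := Set.mem_iUnion.1 (hr ha)
    exact hanti (Nat.zero_le m) ((he m).2 v)
  · refine ((Set.finite_lt_nat k).biUnion fun m _ => Set.finite_range (e m)).subset ?_
    rintro a ⟨ha, hak⟩
    obtain ⟨m, v, rfl⟩ := Set.mem_iUnion.1 (hr ha)
    refine Set.mem_biUnion (show m < k from ?_) ⟨v, rfl⟩
    by_contra! h
    exact hak (hanti h ((he m).2 v))

variable [NeZero n]

theorem exists_inter {r p : P} (h : (D r \ D p).Finite) : ∃ q, D q ⊆ D r ∩ D p :=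
  (hD.large_iff _).1 ((hD.large r).inter_of_diff_finite h)

/-- Countably many questions about the generic extension are decided by a single condition. -/
theorem exists_deciding {ι β : Type*} [Countable ι] (φ : ι → β → Sentence P)
    (hmono : ∀ i b {p q}, q ≤ p → φ i b p → φ i b q)
    (hdense : ∀ i b {p}, (∀ q ≤ p, ∃ r ≤ q, φ i b r) → φ i b p)
    (p : P) (hp : ∀ i, ∀ q ≤ p, ∃ r ≤ q, ∃ b, φ i b r) :
    ∃ r, D r ⊆ D p ∧ ∀ i, ∃ b, φ i b r := by
  rcases isEmpty_or_nonempty ι with hι | hι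
  · exact ⟨p, subset_rfl, fun i => isEmptyElim i⟩
  obtain ⟨f, hf⟩ := exists_surjective_nat ι
  have hstep : ∀ (q : {q // D q ⊆ D p}) (i : ι),
      ∃ r : {q // D q ⊆ D p}, D r.1 ⊆ D q.1 ∧ ∃ b, φ i b r.1 := fun q i => by
    obtain ⟨r, hr, b, hb⟩ := hp i q (hD.le_of_subset q.2)
    obtain ⟨r', hr'⟩ := hD.exists_inter (hD.finite_diff hr)
    have hr'' := Set.subset_inter_iff.1 hr'
    exact ⟨⟨r', hr''.2.trans q.2⟩, hr''.2, b, hmono i b (hD.le_of_subset hr''.1) hb⟩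
  choose step hstep using hstep
  let s : ℕ → {q // D q ⊆ D p} := fun k => Nat.rec ⟨p, subset_rfl⟩ (fun k q => step q (f k)) k
  have hs : ∀ k, s (k + 1) = step (s k) (f k) := fun _ => rfl
  obtain ⟨r, hr0, hr⟩ := hD.exists_pseudo_intersection (fun k => (s k).1) fun k => by
    rw [hs]; exact (hstep _ _).1
  refine ⟨r, hr0, fun i => ?_⟩
  obtain ⟨k, rfl⟩ := hf i
  obtain ⟨b, hb⟩ := (hstep (s k) (f k)).2
  rw [← hs] at hb
  -- `D r` lies in `D (s (k + 1))` only modulo a finite set, which need not give `r ≤ s (k + 1)`.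
  -- But every `q ≤ r` has an extension below `s (k + 1)`, so density suffices.
  refine ⟨b, hdense _ b fun q hq => ?_⟩
  have hfin : (D q \ D (s (k + 1))).Finite := ((hD.finite_diff hq).union (hr (k + 1))).subset
    fun a ha => by
      by_cases h : a ∈ D r
      exacts [Or.inr ⟨h, ha.2⟩, Or.inl ⟨ha.1, h⟩]
  obtain ⟨q', hq'⟩ := hD.exists_inter hfin
  exact ⟨q', hD.le_of_subset (hq'.trans Set.inter_subset_left),
    hmono _ b (hD.le_of_subset (hq'.trans Set.inter_subset_right)) hb⟩

theorem memGenerated_iff {S : Name P α} {p : P} :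
    memGenerated D S p ↔ ∀ q ≤ p, ∃ r ≤ q, ∀ a ∈ D r, mem a S r := by
  constructor
  · intro h q hq
    obtain ⟨r, hr, A, hA, hS⟩ := h q hq
    obtain ⟨r', hr', hr'A⟩ := hA r le_rfl
    obtain ⟨s, hs⟩ := hD.exists_inter (hD.finite_diff hr'A)
    have hsr := (hD.le_of_subset (hs.trans Set.inter_subset_left)).trans hr'
    exact ⟨s, hsr.trans hr, fun a ha => hS a s hsr (hs ha).2⟩
  · intro h q hq
    obtain ⟨r, hr, hS⟩ := h q hq
    exact ⟨r, hr, r, fun q' hq' => ⟨q', le_rfl, hq'⟩, fun a q' hq' ha => mem_of_le (hS a ha) hq'⟩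

theorem memGenerated_check (p : P) : memGenerated D (check (D p)) p :=
  hD.memGenerated_iff.2 fun q hq => by
    obtain ⟨r, hr⟩ := hD.exists_inter (hD.finite_diff hq)
    exact ⟨r, hD.le_of_subset (hr.trans Set.inter_subset_left), fun a ha => mem_check.2 (hr ha).2⟩

theorem forced_isUltrafilter [Countable α] : Forced (isUltrafilter (memGenerated D)) := by
  refine fun p => ⟨fun S p₁ _ hS q hq => ?_, fun S T R p₁ _ h => ?_, fun S q hq => ?_⟩
  · obtain ⟨r, hr, hrS⟩ := hD.memGenerated_iff.1 hS q hq
    obtain ⟨a, ha⟩ := (hD.large r).infinite.nonempty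
    exact ⟨r, hr, a, hrS a ha⟩
  · obtain ⟨⟨hS, hT⟩, hR⟩ := h
    refine hD.memGenerated_iff.2 fun q hq => ?_
    obtain ⟨r, hr, hrS⟩ := hD.memGenerated_iff.1 hS q hq
    obtain ⟨s, hs, hsT⟩ := hD.memGenerated_iff.1 hT r (hr.trans hq)
    obtain ⟨t, ht⟩ := hD.exists_inter (hD.finite_diff hs)
    have hts := hD.le_of_subset (ht.trans Set.inter_subset_left)
    have htr := hD.le_of_subset (ht.trans Set.inter_subset_right)
    exact ⟨t, htr.trans hr, fun a ha => hR a t (htr.trans (hr.trans hq))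
      ⟨mem_of_le (hrS a (ht ha).2) htr, mem_of_le (hsT a (ht ha).1) hts⟩⟩
  -- Below `r` the name `S` denotes the ground-model set `{a | b a}`; partition regularity then
  -- shrinks `D r` into it or its complement.
  · obtain ⟨r, hr, hdec⟩ := hD.exists_deciding
      (fun (a : α) (b : Prop) => fun p => (b → mem a S p) ∧ (¬ b → Forcing.not (mem a S) p))
      (fun a b p q h hp => ⟨fun hb => mem_of_le (hp.1 hb) h,
        fun hb r hr => hp.2 hb r (hr.trans h)⟩)
      (fun a b p h => ⟨fun hb => mem_of_dense fun q hq =>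
          (h q hq).imp fun r hr => ⟨hr.1, hr.2.1 hb⟩,
        fun hb => not_mem_of_dense fun q hq => (h q hq).imp fun r hr => ⟨hr.1, hr.2.2 hb⟩⟩)
      q fun a q _ => by
        by_cases h : ∃ r ≤ q, mem a S r
        · obtain ⟨r, hr, h⟩ := h
          exact ⟨r, hr, True, fun _ => h, fun h => absurd trivial h⟩
        · push Not at h
          exact ⟨q, le_rfl, False, False.elim, fun _ => h⟩
    choose b hb using hdec
    have hrq := hD.le_of_subset hr
    have hL : E.Large ((D r ∩ {a | b a}) ∪ (D r ∩ {a | ¬ b a})) := by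
      rw [← Set.inter_union_distrib_left]
      exact (hD.large r).mono fun a ha => ⟨ha, em (b a)⟩
    rcases hL.or_of_union with h | h <;> obtain ⟨s, hs⟩ := (hD.large_iff _).1 h
    · have hsr := hD.le_of_subset (hs.trans Set.inter_subset_left)
      exact ⟨s, hsr.trans hrq, Or.inl <| memGenerated_of_le (hD.memGenerated_iff.2 fun q hq => by
        obtain ⟨t, ht⟩ := hD.exists_inter (hD.finite_diff hq)
        have htq := hD.le_of_subset (ht.trans Set.inter_subset_left)
        exact ⟨t, htq, fun a ha =>
          mem_of_le ((hb a).1 (hs (ht ha).2).2) (htq.trans (hq.trans hsr))⟩) le_rfl⟩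
    · have hsr := hD.le_of_subset (hs.trans Set.inter_subset_left)
      refine ⟨s, hsr.trans hrq, Or.inr fun q' hq' => ⟨q', le_rfl, check (D s),
        memGenerated_of_le (hD.memGenerated_check s) hq', fun a q'' hq'' ha => ?_⟩⟩
      exact fun t ht => (hb a).2 (hs (mem_check.1 ha)).2 t (ht.trans (hq''.trans (hq'.trans hsr)))

theorem forced_partitionRelation [Countable α] :
    Forced (partitionRelation (memGenerated D) 2 (1 + ∑ i ∈ Finset.range n, 3 ^ i)) := by
  classical
  intro p l p₁ _ hl c p₂ hp₂ hc p₃ hp₃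
  obtain ⟨r, hr, hdec⟩ := hD.exists_deciding
    (fun (s : Subsets α 2) (i : Fin l) => fun p => mem (s, i) c p ∧
      all (fun i' : Fin l => imp (mem (s, i') c) (lift (i' = i))) p)
    (fun s i p q h hp => ⟨mem_of_le hp.1 h, fun i' r hr => hp.2 i' r (hr.trans h)⟩)
    (fun s i p h => ⟨mem_of_dense fun q hq => (h q hq).imp fun r hr => ⟨hr.1, hr.2.1⟩,
      fun i' q hq hm => by
        obtain ⟨r, hr, -, h'⟩ := h q hq
        exact h' i' r le_rfl (mem_of_le hm hr)⟩)
    p₃ fun s q hq => hc s q (hq.trans hp₃)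
  choose col hcol using hdec
  let c' : α → α → Fin l := fun x y =>
    -- The diagonal value is arbitrary.
    if h : x ≠ y then col ⟨{x, y}, Finset.card_pair h⟩ else ⟨0, zero_lt_two.trans_le hl⟩
  obtain ⟨S, hSr, hS, K, hK, hSK⟩ := (hD.large r).exists_few_colours c' fun x y => by
    by_cases h : x = y
    · rw [h]
    · simp only [c', h, Ne.symm h, ne_eq, not_false_eq_true, dite_true, Finset.pair_comm x y]
  obtain ⟨s, hs⟩ := (hD.large_iff S).1 hS
  have hsr := hD.le_of_subset (hs.trans hSr)
  refine ⟨s, hsr.trans (hD.le_of_subset hr), check (D s), hD.memGenerated_check s,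
    fun q hq => ⟨q, le_rfl, K, hK, ?_⟩⟩
  rintro ⟨t, ht⟩ q₁ hq₁ hmem i q₂ hq₂ hi
  obtain ⟨x, y, hxy, rfl⟩ := Finset.card_eq_two.1 ht
  have hx : x ∈ D s := mem_check.1 (hmem x q₁ le_rfl (by simp [lift]))
  have hy : y ∈ D s := mem_check.1 (hmem y q₁ le_rfl (by simp [lift]))
  have hi' : i = col ⟨{x, y}, ht⟩ :=
    (hcol _).2 i q₂ (hq₂.trans (hq₁.trans (hq.trans hsr))) hi
  have := hSK x (hs hx) y (hs hy) hxy
  simp only [c', dif_pos hxy] at this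
  rw [lift, hi']
  exact this

theorem forced_not_partitionRelation {t : ℕ} (ht : 2 ≤ t) (c : Subsets α 2 → Fin t)
    (hc : ∀ S, E.Large S → ∀ i, ∃ s : Subsets α 2, (s.1 : Set α) ⊆ S ∧ c s = i)
    {t' : ℕ} (ht' : t' < t) : Forced (Forcing.not (partitionRelation (memGenerated D) 2 t')) := by
  intro p q _ h
  obtain ⟨r, hrq, X, hX, hcX⟩ := h t q le_rfl ht (check {x | c x.1 = x.2}) q le_rfl
    (fun s q' _ => ⟨q', le_rfl, c s, mem_check.2 rfl, fun i q₁ _ hi => (mem_check.1 hi).symm⟩)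
    q le_rfl
  obtain ⟨r₁, hr₁, K, hK, hcK⟩ := hcX r le_rfl
  obtain ⟨r₂, hr₂, hX₂⟩ := hD.memGenerated_iff.1 hX r₁ hr₁
  have hK' : K = Finset.univ := Finset.eq_univ_iff_forall.2 fun i => by
    obtain ⟨s, hs, rfl⟩ := hc _ (hD.large r₂) i
    exact hcK s r₂ hr₂ (fun a q' hq' ha => mem_of_le (hX₂ a (hs ha)) hq') (c s) r₂ le_rfl
      (mem_check.2 rfl)
  have : K.card ≤ t' := hK
  rw [hK', Finset.card_univ, Fintype.card_fin] at this
  omega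

/-- The Ramsey degree of the generic ultrafilter, provided that some colouring of the pairs takes
all of its colours on every large set. -/
theorem forced_ramseyDegreeEq [Countable α]
    (c : Subsets α 2 → Fin (1 + ∑ i ∈ Finset.range n, 3 ^ i))
    (hc : ∀ S, E.Large S → ∀ i, ∃ s : Subsets α 2, (s.1 : Set α) ⊆ S ∧ c s = i) :
    Forced (ramseyDegreeEq (memGenerated D) 2 (1 + ∑ i ∈ Finset.range n, 3 ^ i)) := by
  have h2 : 2 ≤ 1 + ∑ i ∈ Finset.range n, 3 ^ i := by
    obtain ⟨k, rfl⟩ := Nat.exists_eq_succ_of_ne_zero (NeZero.ne n)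
    rw [Nat.succ_eq_add_one, sum_three_pow_succ]
    omega
  exact fun p => ⟨hD.forced_isUltrafilter p, hD.forced_partitionRelation p,
    fun t' q _ ht' => hD.forced_not_partitionRelation h2 c hc ht' q⟩

/-- The Ramsey degree of the generic ultrafilter, provided that all relative positions of pairs
of related points, and also pairs of unrelated points, occur in every large set. -/
theorem forced_ramseyDegreeEq_of_positions [Countable α] (pos : α → α → Fin n → SignType)
    (hpos : ∀ x y, pos y x = -pos x y) (rel : α → α → Prop) (hrel : ∀ x y, rel x y → rel y x)
    (h₁ : ∀ S, E.Large S → ∀ τ ≠ 0, ∃ x ∈ S, ∃ y ∈ S, x ≠ y ∧ rel x y ∧ pos x y = τ)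
    (h₀ : ∀ S, E.Large S → ∃ x ∈ S, ∃ y ∈ S, x ≠ y ∧ ¬ rel x y) :
    Forced (ramseyDegreeEq (memGenerated D) 2 (1 + ∑ i ∈ Finset.range n, 3 ^ i)) := by
  classical
  -- Nonzero sign vectors have nonzero absolute value, which leaves colour `0` for unrelated pairs.
  let γ : α → α → Fin (1 + ∑ i ∈ Finset.range n, 3 ^ i) := fun x y =>
    if rel x y then ⟨(balanced (pos x y)).natAbs, by
      have := natAbs_balanced_le (pos x y)
      omega⟩ else ⟨0, by omega⟩
  have hγ : ∀ x y, γ x y = γ y x := fun x y => by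
    have : rel x y ↔ rel y x := ⟨hrel x y, hrel y x⟩
    simp only [γ, this, hpos x y, balanced_neg, Int.natAbs_neg]
  have hs : ∀ s : Subsets α 2, ∃ z : α × α, s.1 = {z.1, z.2} := fun s => by
    obtain ⟨x, y, -, h⟩ := Finset.card_eq_two.1 s.2
    exact ⟨(x, y), h⟩
  choose z hz using hs
  have hpair : ∀ x y (h : x ≠ y), γ (z ⟨{x, y}, Finset.card_pair h⟩).1
      (z ⟨{x, y}, Finset.card_pair h⟩).2 = γ x y := fun x y h => by
    have h' := congrArg (fun s : Finset α => (s : Set α)) (hz ⟨{x, y}, Finset.card_pair h⟩)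
    simp only [Finset.coe_insert, Finset.coe_singleton, Set.pair_eq_pair_iff] at h'
    rcases h' with ⟨hx, hy⟩ | ⟨hx, hy⟩
    · rw [← hx, ← hy]
    · rw [← hx, ← hy, hγ]
  refine hD.forced_ramseyDegreeEq (fun s => γ (z s).1 (z s).2) fun S hS i => ?_
  suffices ∃ x ∈ S, ∃ y ∈ S, x ≠ y ∧ γ x y = i by
    obtain ⟨x, hx, y, hy, hxy, h⟩ := this
    refine ⟨⟨{x, y}, Finset.card_pair hxy⟩, ?_, (hpair x y hxy).trans h⟩
    simp [Set.insert_subset_iff, hx, hy]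
  rcases Nat.eq_zero_or_pos i.1 with hi | hi
  · obtain ⟨x, hx, y, hy, hxy, h⟩ := h₀ S hS
    refine ⟨x, hx, y, hy, hxy, ?_⟩
    simp only [γ, h, if_false]
    exact Fin.ext hi.symm
  · obtain ⟨τ, hτ⟩ := exists_balanced_eq (n := n) (i.1 : ℤ) (by
      have := i.2
      simp only [Int.natAbs_natCast]
      omega)
    obtain ⟨x, hx, y, hy, hxy, h, hp⟩ := h₁ S hS τ (fun h => by
      rw [balanced_eq_zero.2 h] at hτ; omega)
    refine ⟨x, hx, y, hy, hxy, ?_⟩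
    simp only [γ, h, if_true, hp, hτ]
    rfl

end Represents

end Cube.System

/-! ### The hypercube spaces -/

namespace Hypercube

open Cube

variable {n : ℕ} {L : Fin n → Type*} [∀ j, LinearOrder (L j)]
  {A : ℕ → (j : Fin n) → Finset (L j)}

theorem nonempty_orderIso_of_card_eq {α : Type*} [LinearOrder α] {s t : Finset α}
    (h : s.card = t.card) : Nonempty (s ≃o t) :=
  ⟨(s.orderIsoOfFin h).symm.trans (t.orderIsoOfFin rfl)⟩

theorem Space.card_str (X : Space A) (k : ℕ) (j : Fin n) : (X.str k j).card = (A k j).card := by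
  obtain ⟨f⟩ := X.str_iso k j
  simpa using Fintype.card_congr f.toEquiv

variable (A) in
/-- The largest member of the space. -/
def Space.top : Space A where
  idx := id
  idx_strictMono := strictMono_id
  str := A
  str_subset _ _ := subset_rfl
  str_iso _ _ := ⟨OrderIso.refl _⟩

variable (A) in
/-- The cubes contained in one level of `AR₁`. -/
def cubes : System (AR1 A) n where
  IsCube m e := ∃ k, ∃ x : (j : Fin n) → Fin m → L j, (∀ j, StrictMono (x j)) ∧
    ∀ v, (e v).1 = (k, fun j => {x j (v j)})
  injective := by
    rintro m e ⟨k, x, hx, he⟩ v w h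
    have := (he v).symm.trans ((congrArg Subtype.val h).trans (he w))
    funext j
    exact (hx j).injective (Finset.singleton_injective (congrFun (Prod.ext_iff.1 this).2 j))
  comp := by
    rintro N m e y ⟨k, x, hx, he⟩ hy
    exact ⟨k, fun j => x j ∘ y j, fun j => (hx j).comp (hy j), fun v => he _⟩

theorem finite_level (k : ℕ) : {a : AR1 A | a.1.1 = k}.Finite := by
  refine Set.Finite.subset (((Set.finite_singleton k).prod (Set.Finite.pi'
    fun j => (A k j).powerset.finite_toSet)).preimage Subtype.val_injective.injOn) ?_
  rintro ⟨a, B, rfl⟩ hk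
  have hk : B.idx 0 = k := hk
  exact ⟨hk, fun j => Finset.mem_coe.2 (Finset.mem_powerset.2 (hk ▸ B.str_subset 0 j))⟩

theorem countable_AR1 : Countable (AR1 A) := by
  rw [← Set.countable_univ_iff]
  refine (Set.countable_iUnion fun k => (finite_level (A := A) k).countable).mono fun a _ => ?_
  exact Set.mem_iUnion.2 ⟨a.1.1, rfl⟩

namespace IsGeneratingSequence

variable (hA : IsGeneratingSequence A)
include hA

theorem monotone (j : Fin n) : Monotone fun k => A k j :=
  monotone_nat_of_le_succ fun k => hA.subset_succ k j

theorem exists_le_card (m : ℕ) : ∃ k, ∀ j, m ≤ (A k j).card := by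
  choose k hk using fun j => hA.exists_embedding j m
  refine ⟨Finset.univ.sup k, fun j => ?_⟩
  obtain ⟨f⟩ := hk j
  have h := Fintype.card_le_of_embedding f.toEmbedding
  simp only [Fintype.card_fin, Fintype.card_coe] at h
  exact h.trans (Finset.card_le_card (hA.monotone j (Finset.le_sup (Finset.mem_univ j))))

theorem exists_singletons {Y : Space A} :
    ∃ y : (j : Fin n) → L j, Y.str 0 = fun j => {y j} := by
  have : ∀ j, ∃ y, Y.str 0 j = {y} := fun j =>
    Finset.card_eq_one.1 ((Y.card_str 0 j).trans (hA.card_zero j))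
  choose y hy using this
  exact ⟨y, funext hy⟩

/-- Drop the first `k` blocks of `X` and thin each remaining block to the required cardinality,
which suffices since finite linear orders of equal size are isomorphic. -/
theorem exists_reduction (X : Space A) (k : ℕ) (y : (j : Fin n) → L j)
    (hy : ∀ j, y j ∈ X.str k j) :
    ∃ Y : Space A, Y.Reduction X ∧ Y.block 0 = (X.idx k, fun j => {y j}) := by
  have : ∀ i j, ∃ T ⊆ X.str (k + i) j, T.card = (A i j).card ∧ (i = 0 → T = {y j}) := by
    intro i j
    rcases Nat.eq_zero_or_pos i with rfl | hi
    · exact ⟨{y j}, by simpa using hy j, by simp [hA.card_zero], fun _ => rfl⟩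
    · obtain ⟨T, hT, hTc⟩ := Finset.exists_subset_card_eq (s := X.str (k + i) j)
        (n := (A i j).card) (by
          rw [X.card_str]
          exact Finset.card_le_card (hA.monotone j (Nat.le_add_left i k)))
      exact ⟨T, hT, hTc, fun h => absurd h hi.ne'⟩
  choose T hT hTc hT0 using this
  exact ⟨{ idx := fun i => X.idx (k + i)
           idx_strictMono := fun i i' h => X.idx_strictMono (by omega)
           str := T
           str_subset := fun i j => (hT i j).trans (X.str_subset _ j)
           str_iso := fun i j => nonempty_orderIso_of_card_eq (hTc i j) },
    fun i => ⟨k + i, rfl, hT i⟩, Prod.ext rfl (funext fun j => hT0 0 j rfl)⟩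

theorem mem_firsts {X : Space A} {a : AR1 A} :
    a ∈ X.firsts ↔ ∃ k, ∃ y : (j : Fin n) → L j, (∀ j, y j ∈ X.str k j) ∧
      a.1 = (X.idx k, fun j => {y j}) := by
  constructor
  · rintro ⟨Y, hY, ha⟩
    obtain ⟨y, hy⟩ := hA.exists_singletons (Y := Y)
    obtain ⟨k, hk, hs⟩ := hY 0
    refine ⟨k, y, fun j => hs j (by simp [hy]), ?_⟩
    rw [← ha, Space.block, hk, hy]
  · rintro ⟨k, y, hy, ha⟩
    obtain ⟨Y, hY, h⟩ := hA.exists_reduction X k y hy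
    exact ⟨Y, hY, h.trans ha.symm⟩

theorem exists_point (k : ℕ) (y : (j : Fin n) → L j) (hy : ∀ j, y j ∈ A k j) :
    ∃ a : AR1 A, a.1 = (k, fun j => {y j}) := by
  obtain ⟨Y, -, h⟩ := hA.exists_reduction (Space.top A) k y hy
  exact ⟨⟨_, Y, h⟩, rfl⟩

theorem exists_coordinates (a : AR1 A) :
    ∃ y : (j : Fin n) → L j, (∀ j, y j ∈ A a.1.1 j) ∧ a.1.2 = fun j => {y j} := by
  obtain ⟨a, B, rfl⟩ := a
  obtain ⟨y, hy⟩ := hA.exists_singletons (Y := B)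
  exact ⟨y, fun j => B.str_subset 0 j (by simp [hy]), hy⟩

theorem large_firsts (X : Space A) : (cubes A).Large X.firsts := by
  intro m
  obtain ⟨k, hk⟩ := hA.exists_le_card m
  have : ∀ j, ∃ x : Fin m → L j, StrictMono x ∧ ∀ i, x i ∈ X.str k j := fun j => by
    obtain ⟨T, hT, hTc⟩ := Finset.exists_subset_card_eq ((hk j).trans_eq (X.card_str k j).symm)
    exact ⟨T.orderEmbOfFin hTc, (T.orderEmbOfFin hTc).strictMono,
      fun i => hT (T.orderEmbOfFin_mem hTc i)⟩
  choose x hx hxX using this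
  choose e he using fun v : Fin n → Fin m => hA.exists_point (X.idx k) (fun j => x j (v j))
    fun j => X.str_subset k j (hxX j (v j))
  exact ⟨e, ⟨_, x, hx, he⟩, fun v => hA.mem_firsts.2 ⟨k, _, fun j => hxX j (v j), he v⟩⟩

/-- Levels are finite, so discarding finitely many of them keeps `S` large; cubes of each required
size thus occur at arbitrarily high levels and can serve as successive blocks. -/
theorem exists_firsts_subset [NeZero n] {S : Set (AR1 A)} (hS : (cubes A).Large S) :
    ∃ X : Space A, X.firsts ⊆ S := by
  let M : ℕ → ℕ := fun i => Finset.univ.sup fun j => (A i j).card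
  have hM : ∀ i j, (A i j).card ≤ M i := fun i j =>
    Finset.le_sup (f := fun j => (A i j).card) (Finset.mem_univ j)
  obtain ⟨φ, hφ, h⟩ := Filter.extraction_forall_of_frequently
    (P := fun i k => ∃ x : (j : Fin n) → Fin (M i) → L j, (∀ j, StrictMono (x j)) ∧
      ∀ v : Fin n → Fin (M i), ∃ a ∈ S, a.1 = (k, fun j => {x j (v j)})) fun i => by
    refine Filter.frequently_atTop.2 fun K => ?_
    have hfin : {a : AR1 A | a.1.1 < K}.Finite :=
      ((Set.finite_lt_nat K).biUnion fun k _ => finite_level (A := A) k).subset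
        fun a ha => Set.mem_biUnion (show a.1.1 < K from ha) rfl
    -- The successor makes the cube nonempty, and its vertex `0` witnesses `K ≤ k`.
    obtain ⟨e, ⟨k, x, hx, he⟩, heS⟩ := hS.diff_finite hfin (M i + 1)
    refine ⟨k, ?_, fun j t => x j t.castSucc, fun j => (hx j).comp Fin.strictMono_castSucc,
      fun v => ⟨_, (heS fun j => (v j).castSucc).1, he _⟩⟩
    have := (heS fun _ => 0).2
    simpa [he] using this
  choose x hx hxS using h
  choose a haS ha using hxS
  have hmem : ∀ i j (t : Fin (M i)), x i j t ∈ A (φ i) j := fun i j t => by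
    obtain ⟨y, hy, hay⟩ := hA.exists_coordinates (a i fun _ => t)
    have := congrFun hay j
    rw [ha] at this
    rw [Finset.singleton_injective this]
    simpa [ha] using hy j
  let X : Space A :=
    { idx := φ
      idx_strictMono := hφ
      str := fun i j => Finset.univ.image (x i j ∘ Fin.castLE (hM i j))
      str_subset := fun i j y hy => by
        obtain ⟨t, -, rfl⟩ := Finset.mem_image.1 hy
        exact hmem i j _
      str_iso := fun i j => nonempty_orderIso_of_card_eq (by
        rw [Finset.card_image_of_injective _
          ((hx i j).comp (Fin.strictMono_castLE (hM i j))).injective]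
        simp) }
  refine ⟨X, fun b hb => ?_⟩
  obtain ⟨i, y, hy, hb⟩ := hA.mem_firsts.1 hb
  have : ∀ j, ∃ t, x i j t = y j := fun j => by
    obtain ⟨t, -, ht⟩ := Finset.mem_image.1 (hy j)
    exact ⟨_, ht⟩
  choose v hv using this
  have : b = a i v := Subtype.ext (hb.trans (by rw [ha]; simp only [hv]; rfl))
  exact this ▸ haS i v

theorem represents [NeZero n] : (cubes A).Represents (Space.firsts (A := A)) where
  le_of_subset {r p} h := show (r.firsts \ p.firsts).Finite by
    rw [Set.sdiff_eq_empty.2 h]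
    exact Set.finite_empty
  finite_diff h := h
  large_iff S := ⟨hA.exists_firsts_subset, fun ⟨X, hX⟩ => (hA.large_firsts X).mono hX⟩

theorem forced_ramseyDegreeEq [NeZero n] :
    Forcing.Forced (Forcing.ramseyDegreeEq (memUltrafilter (A := A)) 2
      (1 + ∑ i ∈ Finset.range n, 3 ^ i)) := by
  have := countable_AR1 (A := A)
  choose y _ hy using hA.exists_coordinates
  refine hA.represents.forced_ramseyDegreeEq_of_positions
    (fun a b j => cmpSign (y a j) (y b j)) (fun a b => funext fun j => cmpSign_swap _ _)
    (fun a b => a.1.1 = b.1.1) (fun _ _ h => h.symm) (fun S hS τ hτ => ?_) fun S hS => ?_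
  -- A cube of side 2 lies on one level and realises every sign vector.
  · obtain ⟨e, ⟨k, x, hx, he⟩, heS⟩ := hS 2
    choose v w _ _ hvw using fun j => exists_cmpSign_eq (show (0 : Fin 2) < 1 by decide) (τ j)
    have hye : ∀ v j, y (e v) j = x j (v j) := fun v j => by
      have := congrFun (hy (e v)) j
      rw [he] at this
      exact (Finset.singleton_injective this).symm
    refine ⟨e v, heS v, e w, heS w, fun h => hτ ?_, by rw [he, he], ?_⟩
    · rw [← funext hvw, (cubes A).injective ⟨k, x, hx, he⟩ h]
      exact funext fun j => cmpSign_eq_zero.2 rfl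
    · funext j
      rw [hye, hye, (hx j).cmpSign_eq, hvw]
  · obtain ⟨a, ha⟩ := hS.infinite.nonempty
    by_contra! h
    refine hS.infinite ((finite_level (A := A) a.1.1).subset fun b hb => ?_)
    by_cases hab : a = b
    · rw [hab]; rfl
    · exact (h a ha b hb hab).symm

end IsGeneratingSequence

end Hypercube

/-! ### Blass' square forcing -/

namespace Blass

open Cube

/-- The squares in `ω × ω`. -/
def squares : System (ℕ × ℕ) 2 where
  IsCube m e := ∃ x y : Fin m → ℕ, StrictMono x ∧ StrictMono y ∧ ∀ v, e v = (x (v 0), y (v 1))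
  injective := by
    rintro m e ⟨x, y, hx, hy, he⟩ v w h
    rw [he, he, Prod.mk.injEq] at h
    funext j
    fin_cases j
    exacts [hx.injective h.1, hy.injective h.2]
  comp := by
    rintro N m e z ⟨x, y, hx, hy, he⟩ hz
    exact ⟨x ∘ z 0, y ∘ z 1, hx.comp (hz 0), hy.comp (hz 1), fun v => he _⟩

theorem exists_square {S : Set (ℕ × ℕ)} (hS : squares.Large S) (m : ℕ) :
    ∃ x y : Fin m → ℕ, StrictMono x ∧ StrictMono y ∧ ∀ i k, (x i, y k) ∈ S := by
  obtain ⟨e, ⟨x, y, hx, hy, he⟩, heS⟩ := hS m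
  exact ⟨x, y, hx, hy, fun i k => by simpa [he] using heS ![i, k]⟩

theorem large_iff {S : Set (ℕ × ℕ)} : squares.Large S ↔
    ∀ m : ℕ, ∃ s t : Finset ℕ, s.card = m ∧ t.card = m ∧ (s : Set ℕ) ×ˢ (t : Set ℕ) ⊆ S := by
  constructor
  · intro hS m
    obtain ⟨x, y, hx, hy, h⟩ := exists_square hS m
    refine ⟨Finset.univ.image x, Finset.univ.image y, ?_, ?_, ?_⟩
    · rw [Finset.card_image_of_injective _ hx.injective]; simp
    · rw [Finset.card_image_of_injective _ hy.injective]; simp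
    · rintro ⟨a, b⟩ ⟨ha, hb⟩
      simp only [Finset.coe_image, Finset.coe_univ, Set.image_univ, Set.mem_range] at ha hb
      obtain ⟨i, rfl⟩ := ha
      obtain ⟨k, rfl⟩ := hb
      exact h i k
  · intro h m
    obtain ⟨s, t, hs, ht, hst⟩ := h m
    exact ⟨fun v => (s.orderEmbOfFin hs (v 0), t.orderEmbOfFin ht (v 1)),
      ⟨_, _, (s.orderEmbOfFin hs).strictMono, (t.orderEmbOfFin ht).strictMono, fun _ => rfl⟩,
      fun v => hst ⟨s.orderEmbOfFin_mem hs _, t.orderEmbOfFin_mem ht _⟩⟩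

theorem represents : squares.Represents fun X : SquareForcing => X.1 where
  le_of_subset h := h
  finite_diff {r p} h := by
    rw [Set.sdiff_eq_empty.2 (show r.1 ⊆ p.1 from h)]
    exact Set.finite_empty
  large_iff S := ⟨fun h => ⟨⟨S, large_iff.1 h⟩, subset_rfl⟩,
    fun ⟨X, hX⟩ => (large_iff.2 X.2).mono hX⟩

/-- The point `b` lies above the least square `[0, k) × [0, k)` that contains `a`. -/
def Far (a b : ℕ × ℕ) : Prop := max a.1 a.2 < min b.1 b.2

/-- In a 3-square with `x 1 ≤ y 1`, the points `(x 0, y 1)` and `(x 1, y 2)` increase in both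
coordinates, but `y 1` blocks `Far`; the other case is symmetric. -/
theorem exists_near_lt {S : Set (ℕ × ℕ)} (hS : squares.Large S) :
    ∃ a ∈ S, ∃ b ∈ S, a.1 < b.1 ∧ a.2 < b.2 ∧ ¬ Far a b := by
  obtain ⟨x, y, hx, hy, h⟩ := exists_square hS 3
  have hx₀ : x 0 < x 1 := hx (by decide)
  have hx₁ : x 1 < x 2 := hx (by decide)
  have hy₀ : y 0 < y 1 := hy (by decide)
  have hy₁ : y 1 < y 2 := hy (by decide)
  rcases le_total (x 1) (y 1) with hxy | hxy
  · refine ⟨_, h 0 1, _, h 1 2, hx₀, hy₁, ?_⟩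
    simp only [Far]
    omega
  · refine ⟨_, h 1 0, _, h 2 1, hx₁, hy₀, ?_⟩
    simp only [Far]
    omega

theorem exists_far {S : Set (ℕ × ℕ)} (hS : squares.Large S) : ∃ a ∈ S, ∃ b ∈ S, Far a b := by
  obtain ⟨a, ha⟩ := hS.infinite.nonempty
  -- The last index is `max a.1 a.2 + 1`, and a strictly increasing sequence of naturals dominates
  -- its index.
  obtain ⟨x, y, hx, hy, h⟩ := exists_square hS (max a.1 a.2 + 2)
  refine ⟨a, ha, _, h (Fin.last _) (Fin.last _), ?_⟩
  have hle : ∀ {m : ℕ} {z : Fin m → ℕ}, StrictMono z → ∀ i, i.1 ≤ z i := by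
    intro m z hz
    rintro ⟨i, hi⟩
    induction i with
    | zero => exact Nat.zero_le _
    | succ i ih => exact (ih (by omega)).trans_lt (hz (Fin.mk_lt_mk.2 (Nat.lt_succ_self i)))
  have h₁ := hle hx (Fin.last _)
  have h₂ := hle hy (Fin.last _)
  simp only [Fin.val_last] at h₁ h₂
  simp only [Far]
  omega

theorem forced_ramseyDegreeEq : Forcing.Forced (Forcing.ramseyDegreeEq memUltrafilter 2 5) := by
  refine represents.forced_ramseyDegreeEq_of_positions
    (fun a b => ![cmpSign a.1 b.1, cmpSign a.2 b.2]) (fun a b => ?_)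
    (fun a b => ¬ Far a b ∧ ¬ Far b a) (fun a b h => h.symm) (fun S hS τ hτ => ?_) fun S hS => ?_
  · funext j
    fin_cases j
    exacts [cmpSign_swap _ _, cmpSign_swap _ _]
  -- Only the sign vectors `(1, 1)` and `(-1, -1)` can come from far pairs and need
  -- `exists_near_lt`; for the others any 2-square will do.
  · by_cases h₁ : τ 0 = 1 ∧ τ 1 = 1
    · obtain ⟨a, ha, b, hb, h, h', hab⟩ := exists_near_lt hS
      refine ⟨a, ha, b, hb, fun e => h.ne (congrArg _ e), ⟨hab, ?_⟩, ?_⟩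
      · simp only [Far]; omega
      · funext j
        fin_cases j <;> simp [cmpSign, h, h', h₁]
    by_cases h₂ : τ 0 = -1 ∧ τ 1 = -1
    · obtain ⟨a, ha, b, hb, h, h', hab⟩ := exists_near_lt hS
      refine ⟨b, hb, a, ha, fun e => h.ne' (congrArg _ e), ⟨?_, hab⟩, ?_⟩
      · simp only [Far]; omega
      · funext j
        fin_cases j <;> simp [cmpSign, h, h', h.not_gt, h'.not_gt, h₂]
    obtain ⟨x, y, hx, hy, h⟩ := exists_square hS 2
    obtain ⟨i, i', -, -, hi⟩ := exists_cmpSign_eq (show (0 : Fin 2) < 1 by decide) (τ 0)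
    obtain ⟨k, k', -, -, hk⟩ := exists_cmpSign_eq (show (0 : Fin 2) < 1 by decide) (τ 1)
    rw [← hx.cmpSign_eq] at hi
    rw [← hy.cmpSign_eq] at hk
    have hpos : ![cmpSign (x i) (x i'), cmpSign (y k) (y k')] = τ := by
      funext j
      fin_cases j
      exacts [hi, hk]
    refine ⟨_, h i k, _, h i' k', fun e => hτ ?_, ⟨fun hf => h₁ ?_, fun hf => h₂ ?_⟩, hpos⟩
    · rw [Prod.mk.injEq] at e
      rw [← hpos, cmpSign_eq_zero.2 e.1, cmpSign_eq_zero.2 e.2]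
      funext j
      fin_cases j <;> rfl
    · simp only [Far] at hf
      rw [← hi, ← hk]
      simp [cmpSign, show x i < x i' by omega, show y k < y k' by omega]
    · simp only [Far] at hf
      rw [← hi, ← hk]
      have h₃ : x i' < x i := by omega
      have h₄ : y k' < y k := by omega
      simp [cmpSign, h₃, h₄, h₃.not_gt, h₄.not_gt]
  · obtain ⟨a, ha, b, hb, h⟩ := exists_far hS
    refine ⟨a, ha, b, hb, fun e => ?_, fun h' => h'.1 h⟩
    subst e
    simp only [Far] at h
    omega

end Blass

theorem mainTheorem4 :
    (∀ (n : ℕ) (_ : 2 ≤ n) (L : Fin n → Type*) [∀ j, LinearOrder (L j)]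
      (A : ℕ → (j : Fin n) → Finset (L j)) (_ : Hypercube.IsGeneratingSequence A),
      Forcing.Forced (Forcing.ramseyDegreeEq (Hypercube.memUltrafilter (A := A)) 2
        (1 + ∑ i ∈ Finset.range n, 3 ^ i))) ∧
    (∀ (L : Fin 2 → Type*) [∀ j, LinearOrder (L j)]
      (A : ℕ → (j : Fin 2) → Finset (L j)) (_ : Hypercube.IsGeneratingSequence A),
      Forcing.Forced (Forcing.ramseyDegreeEq (Hypercube.memUltrafilter (A := A)) 2 5)) ∧
    Forcing.Forced (Forcing.ramseyDegreeEq Blass.memUltrafilter 2 5) := by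
  refine ⟨fun n hn L _ A hA => ?_, fun L _ A hA => ?_, Blass.forced_ramseyDegreeEq⟩
  · have : NeZero n := ⟨by omega⟩
    exact hA.forced_ramseyDegreeEq
  · exact hA.forced_ramseyDegreeEq
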